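/- Let $k\ge 0$ and $[k]=\{1,\dots,k\}$. For $A,B\subseteq[k]$ say that $A$ splits $B$ if $|A\cap B|=|B|/2$ when $|B|$ is even, and $|A\cap B|=(|B|\pm1)/2$ when $|B|$ is odd. A family $\{B_1,B_2\}$ of subsets of $[k]$ (the case $B_1=B_2$ is allowed) has arrangement $(a_1,b,a_2,d)$, where $a_1=|B_1\setminus B_2|$, $b=|B_1\cap B_2|$, $a_2=|B_2\setminus B_1|$ and $d=|[k]\setminus(B_1\cup B_2)|$, so that $k=a_1+b+a_2+d$. Its number of splitters is the number of sets $A\subseteq[k]$ that split both $B_1$ and $B_2$. Then, for fixed $k$, the number of splitters of a family $\{B_1,B_2\}$ on $[k]$ is minimized by the following arrangements (each of which is the arrangement of some family on $[k]$): - if $k\equiv0\pmod 3$: at $(m,m,m,0)$, where $m=k/3$; - if $k\equiv1\pmod 3$ and $k\ge4$: at $(m-2,m,m,0)$, where $m=(k+2)/3$; - if $k\equiv2\pmod 3$: at $(m,m,m+2,0)$, where $m=(k-2)/3$. Moreover, the minimum number $M_k$ of splitters of a family $\{B_1,B_2\}$ on $[k]$ is asymptotic to a positive constant times $2^k/k$;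 precisely, $$\lim_{k\to\infty}\frac{M_k}{2^k/k}=\frac{2\sqrt3}{\pi}.$$ -/

import Mathlib

/-- `A` splits `B`: `|A ∩ B| = |B| / 2` if `|B|` is even, and `|A ∩ B| = (|B| ± 1) / 2` if `|B|`
is odd. Subsets of `[k]` are modelled as `Finset (Fin k)`. -/
def Splits {k : ℕ} (A B : Finset (Fin k)) : Prop :=
  (Even B.card ∧ 2 * (A ∩ B).card = B.card) ∨
    (Odd B.card ∧ (2 * (A ∩ B).card = B.card + 1 ∨ 2 * (A ∩ B).card + 1 = B.card))

open Classical in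
/-- The number of sets `A ⊆ [k]` that split both `B₁` and `B₂`. -/
noncomputable def numSplitters {k : ℕ} (B₁ B₂ : Finset (Fin k)) : ℕ :=
  (Finset.univ.filter fun A : Finset (Fin k) => Splits A B₁ ∧ Splits A B₂).card

/-- `{B₁, B₂}` has arrangement `(a₁, b, a₂, d)`. -/
def HasArrangement {k : ℕ} (B₁ B₂ : Finset (Fin k)) (a₁ b a₂ d : ℕ) : Prop :=
  (B₁ \ B₂).card = a₁ ∧ (B₁ ∩ B₂).card = b ∧ (B₂ \ B₁).card = a₂ ∧ (B₁ᶜ ∩ B₂ᶜ).card = d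

/-- `(a₁, b, a₂, d)` is the arrangement of some family `{B₁, B₂}` on `[k]`, and every family with
this arrangement has the least number of splitters among all families `{C₁, C₂}` on `[k]`. -/
def MinimizesSplitters (k a₁ b a₂ d : ℕ) : Prop :=
  (∃ B₁ B₂ : Finset (Fin k), HasArrangement B₁ B₂ a₁ b a₂ d) ∧
    ∀ B₁ B₂ : Finset (Fin k), HasArrangement B₁ B₂ a₁ b a₂ d →
      ∀ C₁ C₂ : Finset (Fin k), numSplitters B₁ B₂ ≤ numSplitters C₁ C₂

/-- The minimum number of splitters of a family `{B₁, B₂}` on `[k]`. -/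
noncomputable def minSplitters (k : ℕ) : ℕ :=
  ⨅ p : Finset (Fin k) × Finset (Fin k), numSplitters p.1 p.2

/-!
Read a set `A` as a choice of signs, `+1` on `A` and `-1` off `A`. Then `A` splits `B` exactly if
the signs on `B` have a sum of absolute value at most `1`. After a change of sign on `B₁ ∩ B₂`, a
common splitter of `B₁` and `B₂` is a triple of walks with steps `±1`, of `a`, `b` and `c` steps,
such that the end point of the middle one is within distance `1` of the two others, together with
an arbitrary subset of the `d` points outside. A defect of parity between two walks is removed by
one more step of the outer one, so the number of splitters is `2 ^ d * meetCount a' b c'`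
(`numSplitters_eq`), where `meetCount` counts triples of walks that end at the same point, and
`a' ∈ {a, a + 1}`, `c' ∈ {c, c + 1}` have the parity of `b`.

Three inequalities for `meetCount` give the minimum. Each follows from a manifestly nonnegative sum:
* `meetCount_balance_le`: making two lengths more equal decreases the count. The difference is
  summed by parts and uses the log-concavity of the binomial coefficients. Hence the most
  balanced triple, whose count is `balancedCount n`, is optimal among triples of equal parity with sum
  `n`.
* `meetCount_add_one_le`: `meetCount (x + 1) (y + 1) z ≤ 2 * meetCount x y (z + 1)`. It gives
  `balancedCount (n + 1) ≤ 2 * balancedCount n` for `n ≥ 2`, so points outside both sets do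
  not help.
* `two_mul_meetCount_le`: two more steps at least double the count, so the parity corrections do not
  help either.

For the asymptotics, `balancedCount k / 2 ^ k` is decreasing for `k ≥ 2`, so an arithmetic
progression of values of `k` suffices, and for `k = 6 * r` the count is `∑ t, (2 * r).choose t ^
3`. Let `φ r t` be the binomial coefficient at distance `t` from the centre of the row `2 * r`,
divided by the central one. If `r = 3 * q + 1`, then `φ q t ≤ φ r t ^ 3`, and the left side sums
to `4 ^ q / (2 * q).choose q`; in the other direction `φ r t ≤ exp (-t ^ 2 / (r + 1 / 2))`, whose
cubes are compared with a Gaussian integral. Both bounds for `∑ t, φ r t ^ 3` are asymptotic to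
`√(π * r / 3)`, and Wallis' product gives the central binomial coefficients.
-/

/-! ### Sums over the end points of simple walks -/

/-- The sum of `f (ε₁ + ⋯ + εₙ)` over all `2 ^ n` choices of signs `εᵢ = ±1`. -/
def walkSum : ℕ → (ℤ → ℝ) → ℝ
  | 0, f => f 0
  | n + 1, f => walkSum n fun s => f (s - 1) + f (s + 1)

/-- The number of sequences of `n` signs `±1` with sum `s`: the binomial coefficient
`n.choose ((n + s) / 2)` if `n + s` is even and `|s| ≤ n`, and `0` otherwise. The recursion avoids
the case distinctions of the closed form. -/
def walkCount : ℕ → ℤ → ℝ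
  | 0, s => if s = 0 then 1 else 0
  | n + 1, s => walkCount n (s - 1) + walkCount n (s + 1)

theorem walkCount_succ (n : ℕ) (s : ℤ) :
    walkCount (n + 1) s = walkCount n (s - 1) + walkCount n (s + 1) := rfl

theorem walkCount_nonneg (n : ℕ) (s : ℤ) : 0 ≤ walkCount n s := by
  induction n generalizing s with
  | zero => unfold walkCount; positivity
  | succ n ih => exact add_nonneg (ih _) (ih _)

theorem walkCount_neg (n : ℕ) (s : ℤ) : walkCount n (-s) = walkCount n s := by
  induction n generalizing s with
  | zero => simp [walkCount]
  | succ n ih =>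
    rw [walkCount_succ, walkCount_succ, ← ih (s - 1), ← ih (s + 1), add_comm]
    congr 2 <;> ring

theorem walkCount_eq_zero_of_lt_abs {n : ℕ} {s : ℤ} (h : (n : ℤ) < |s|) : walkCount n s = 0 := by
  induction n generalizing s with
  | zero =>
    have : s ≠ 0 := by rintro rfl; simp at h
    simp [walkCount, this]
  | succ n ih =>
    rw [walkCount_succ, ih, ih, add_zero] <;> grind

theorem walkCount_eq_zero_of_odd {n : ℕ} {s : ℤ} (h : Odd (s + n)) : walkCount n s = 0 := by
  induction n generalizing s with
  | zero =>
    have : s ≠ 0 := by rintro rfl; simp at h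
    simp [walkCount, this]
  | succ n ih =>
    rw [walkCount_succ, ih, ih, add_zero] <;> grind

theorem walkSum_add (n : ℕ) (f g : ℤ → ℝ) :
    walkSum n (fun s => f s + g s) = walkSum n f + walkSum n g := by
  induction n generalizing f g with
  | zero => rfl
  | succ n ih => simp only [walkSum, ← ih]; congr 1; ext s; ring

theorem walkSum_mul_left (n : ℕ) (c : ℝ) (f : ℤ → ℝ) :
    walkSum n (fun s => c * f s) = c * walkSum n f := by
  induction n generalizing f with
  | zero => rfl
  | succ n ih => simp only [walkSum, ← ih]; congr 1; ext s; ring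

theorem walkSum_sub (n : ℕ) (f g : ℤ → ℝ) :
    walkSum n (fun s => f s - g s) = walkSum n f - walkSum n g := by
  induction n generalizing f g with
  | zero => rfl
  | succ n ih => simp only [walkSum, ← ih]; congr 1; ext s; ring

theorem walkSum_sum {ι : Type*} (n : ℕ) (t : Finset ι) (f : ι → ℤ → ℝ) :
    walkSum n (fun s => ∑ i ∈ t, f i s) = ∑ i ∈ t, walkSum n (f i) := by
  induction n generalizing f with
  | zero => rfl
  | succ n ih => simp only [walkSum, ← ih, Finset.sum_add_distrib]

/-- Only the integers that `n` signs can reach matter for `walkSum n`. -/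
theorem walkSum_le_walkSum {n : ℕ} {f g : ℤ → ℝ}
    (h : ∀ s : ℤ, |s| ≤ n → Even (s + n) → f s ≤ g s) : walkSum n f ≤ walkSum n g := by
  induction n generalizing f g with
  | zero => exact h 0 (by simp) (by simp)
  | succ n ih =>
    refine ih fun s hs he => add_le_add (h _ ?_ ?_) (h _ ?_ ?_) <;> grind

theorem walkSum_congr {n : ℕ} {f g : ℤ → ℝ}
    (h : ∀ s : ℤ, |s| ≤ n → Even (s + n) → f s = g s) : walkSum n f = walkSum n g :=
  le_antisymm (walkSum_le_walkSum fun s h₁ h₂ => (h s h₁ h₂).le)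
    (walkSum_le_walkSum fun s h₁ h₂ => (h s h₁ h₂).ge)

theorem walkSum_single (n : ℕ) (t : ℤ) :
    walkSum n (fun s => if s = t then 1 else 0) = walkCount n t := by
  induction n generalizing t with
  | zero => simp [walkSum, walkCount, eq_comm]
  | succ n ih =>
    rw [walkCount_succ, ← ih, ← ih, ← walkSum_add, walkSum, add_comm]
    congr 1; ext s
    rw [add_comm]
    congr 2 <;> (apply propext; constructor <;> intro h <;> linarith)

theorem walkSum_eq_sum {n N : ℕ} (h : n ≤ N) (f : ℤ → ℝ) :
    walkSum n f = ∑ s ∈ Finset.Icc (-N : ℤ) N, walkCount n s * f s := by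
  have : ∀ s : ℤ, |s| ≤ n → Even (s + n) →
      f s = ∑ t ∈ Finset.Icc (-N : ℤ) N, f t * (if s = t then 1 else 0) := by
    intro s hs _
    have hm : s ∈ Finset.Icc (-N : ℤ) N := by
      rw [Finset.mem_Icc]; constructor <;> grind
    simp [hm]
  rw [walkSum_congr this, walkSum_sum]
  refine Finset.sum_congr rfl fun t _ => ?_
  rw [walkSum_mul_left, walkSum_single, mul_comm]

theorem walkSum_one (n : ℕ) : walkSum n (fun _ => 1) = 2 ^ n := by
  induction n with
  | zero => simp [walkSum]
  | succ n ih =>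
    rw [walkSum, pow_succ, ← ih, mul_comm, ← walkSum_mul_left]
    congr 1; ext s; norm_num

/-- The ratio of neighbouring binomial coefficients, in the symmetric form. -/
theorem walkCount_ratio (n : ℕ) (s : ℤ) :
    (n + 1 + s) * walkCount n (s + 1) = (n + 1 - s) * walkCount n (s - 1) := by
  induction n generalizing s with
  | zero =>
    rcases eq_or_ne s 1 with rfl | h1
    · norm_num [walkCount]
    rcases eq_or_ne s (-1) with rfl | h2
    · norm_num [walkCount]
    have h3 : s + 1 ≠ 0 := by omega
    have h4 : s - 1 ≠ 0 := by omega
    simp [walkCount, h3, h4]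
  | succ n ih =>
    have h1 := ih (s + 1)
    have h2 := ih (s - 1)
    simp only [walkCount_succ, add_sub_cancel_right, sub_add_cancel] at *
    push_cast at *
    linear_combination h1 + h2

theorem walkCount_add_one_le {n : ℕ} {t : ℤ} (ht : 0 ≤ t) :
    walkCount n (t + 1) ≤ walkCount n (t - 1) := by
  have h := walkCount_ratio n t
  have ht' : (0 : ℝ) ≤ t := by exact_mod_cast ht
  have h0 := walkCount_nonneg n (t - 1)
  have hn : (0 : ℝ) ≤ n := n.cast_nonneg
  by_contra! hlt
  nlinarith

theorem walkCount_sub_one_le {n : ℕ} {t : ℤ} (ht : t ≤ 0) :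
    walkCount n (t - 1) ≤ walkCount n (t + 1) := by
  rw [← walkCount_neg n (t - 1), ← walkCount_neg n (t + 1)]
  have := walkCount_add_one_le (n := n) (t := -t) (by omega)
  convert this using 2 <;> ring

theorem two_mul_walkCount_le (n : ℕ) (s : ℤ) : 2 * walkCount n s ≤ walkCount (n + 2) s := by
  rw [walkCount_succ, walkCount_succ, walkCount_succ, sub_add_cancel, add_sub_cancel_right]
  linarith [walkCount_nonneg n (s - 1 - 1), walkCount_nonneg n (s + 1 + 1)]

/-- Summation by parts: the differences of an odd function that is nonnegative on the right have a
nonnegative sum. -/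
theorem walkSum_sub_nonneg_of_odd {n : ℕ} {h : ℤ → ℝ} (hodd : ∀ t, h (-t) = -h t)
    (hpos : ∀ t, 0 ≤ t → 0 ≤ h t) : 0 ≤ walkSum n fun s => h (s + 1) - h (s - 1) := by
  induction n generalizing h with
  | zero =>
    have := hodd 1
    have := hpos 1 (by norm_num)
    simp only [walkSum, zero_add, zero_sub]
    linarith
  | succ n ih =>
    have := ih (h := fun t => h (t + 1) + h (t - 1)) (fun t => ?_) (fun t ht => ?_)
    · rw [walkSum]
      convert this using 2
      ext s
      simp only [sub_add_cancel, add_sub_cancel_right]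
      ring
    · have h1 := hodd (t + 1)
      have h2 := hodd (t - 1)
      rw [neg_add, ← sub_eq_add_neg] at h1
      rw [neg_sub, sub_eq_add_neg, add_comm] at h2
      linarith
    · rcases ht.eq_or_lt with rfl | ht
      · have := hodd 1
        simp only [zero_add, zero_sub]
        linarith
      · exact add_nonneg (hpos _ (by omega)) (hpos _ (by omega))

/-! ### Three walks with a common end point -/

/-- The number of triples of walks with `x`, `y` and `z` steps `±1` and equal end points. -/
def meetCount (x y z : ℕ) : ℝ :=
  walkSum z fun s => walkCount x s * walkCount y s

theorem meetCount_eq_sum {x y z N : ℕ} (h : z ≤ N) :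
    meetCount x y z =
      ∑ s ∈ Finset.Icc (-N : ℤ) N, walkCount x s * walkCount y s * walkCount z s := by
  rw [meetCount, walkSum_eq_sum h]
  exact Finset.sum_congr rfl fun s _ => by ring

theorem meetCount_comm (x y z : ℕ) : meetCount x y z = meetCount y x z := by
  simp only [meetCount, mul_comm]

theorem meetCount_swap (x y z : ℕ) : meetCount x y z = meetCount x z y := by
  rw [meetCount_eq_sum (le_max_left z y), meetCount_eq_sum (le_max_right z y)]
  exact Finset.sum_congr rfl fun s _ => by ring

theorem meetCount_nonneg (x y z : ℕ) : 0 ≤ meetCount x y z := by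
  rw [meetCount_eq_sum le_rfl]
  exact Finset.sum_nonneg fun s _ => mul_nonneg
    (mul_nonneg (walkCount_nonneg _ _) (walkCount_nonneg _ _)) (walkCount_nonneg _ _)

theorem two_mul_meetCount_le (x y z : ℕ) : 2 * meetCount x y z ≤ meetCount (x + 2) y z := by
  rw [meetCount, meetCount, ← walkSum_mul_left]
  refine walkSum_le_walkSum fun s _ _ => ?_
  rw [← mul_assoc]
  exact mul_le_mul_of_nonneg_right (two_mul_walkCount_le x s) (walkCount_nonneg y s)

/-- Shortening one walk by a step and lengthening each of the two others by a step at most doubles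
the number of meetings. Summand by summand the defect is the product of the increments of two even
unimodal functions, and these have the same sign. -/
theorem meetCount_add_one_le (x y z : ℕ) :
    meetCount (x + 1) (y + 1) z ≤ 2 * meetCount x y (z + 1) := by
  rw [meetCount, meetCount, walkSum, ← walkSum_mul_left]
  refine walkSum_le_walkSum fun s _ _ => ?_
  rw [walkCount_succ, walkCount_succ]
  suffices 0 ≤ (walkCount x (s + 1) - walkCount x (s - 1)) *
      (walkCount y (s + 1) - walkCount y (s - 1)) by linarith
  rcases le_total 0 s with hs | hs
  · exact mul_nonneg_of_nonpos_of_nonpos (sub_nonpos.2 (walkCount_add_one_le hs))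
      (sub_nonpos.2 (walkCount_add_one_le hs))
  · exact mul_nonneg (sub_nonneg.2 (walkCount_sub_one_le hs))
      (sub_nonneg.2 (walkCount_sub_one_le hs))

/-- Log-concavity of binomial coefficients in the form of comparing increments. -/
theorem walkCount_mul_le {x u : ℕ} (h : x ≤ u) {t : ℤ} (ht : 0 ≤ t) :
    walkCount u (t - 1) * walkCount x (t + 1) ≤ walkCount x (t - 1) * walkCount u (t + 1) := by
  have hx := walkCount_ratio x t
  have hu := walkCount_ratio u t
  have ht' : (0 : ℝ) ≤ t := by exact_mod_cast ht
  have hxu : (x : ℝ) ≤ u := by exact_mod_cast h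
  have h0 : (0 : ℝ) ≤ x := x.cast_nonneg
  have hpx : (0 : ℝ) < x + 1 + t := by linarith
  have hpu : (0 : ℝ) < u + 1 + t := by linarith
  have hP := mul_nonneg (walkCount_nonneg x (t - 1)) (walkCount_nonneg u (t - 1))
  refine le_of_mul_le_mul_left ?_ (mul_pos hpx hpu)
  have key : 0 ≤ 2 * t * (u - x) * (walkCount x (t - 1) * walkCount u (t - 1)) :=
    mul_nonneg (mul_nonneg (by linarith) (by linarith)) hP
  linear_combination key + (u + 1 + t) * walkCount u (t - 1) * hx
    - (x + 1 + t) * walkCount x (t - 1) * hu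

/-- Balancing two of the lengths decreases the number of meetings. -/
theorem meetCount_balance_le {x u : ℕ} (h : x ≤ u) (z : ℕ) :
    meetCount (x + 2) u z ≤ meetCount x (u + 2) z := by
  rw [← sub_nonneg, meetCount, meetCount, ← walkSum_sub]
  have := walkSum_sub_nonneg_of_odd (n := z)
    (h := fun t => walkCount x (t - 1) * walkCount u (t + 1)
      - walkCount u (t - 1) * walkCount x (t + 1)) (fun t => ?_)
    (fun t ht => sub_nonneg.2 (walkCount_mul_le h ht))
  · convert this using 2
    ext s
    simp only [walkCount_succ, sub_add_cancel, add_sub_cancel_right]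
    ring
  · have e1 : -t - 1 = -(t + 1) := by ring
    have e2 : -t + 1 = -(t - 1) := by ring
    simp only [e1, e2, walkCount_neg]
    ring

/-! ### The balanced triples minimize the number of meetings -/

/-- The number of meetings for the most balanced triple of lengths of equal parity with sum `k`.
There is no triple of equal parity with sum `1`; there the value is `meetCount 0 1 1 = 0`. -/
def balancedCount (k : ℕ) : ℝ :=
  if k % 3 = 0 then meetCount (k / 3) (k / 3) (k / 3)
  else if k % 3 = 1 then meetCount (k / 3 - 1) (k / 3 + 1) (k / 3 + 1)
  else meetCount (k / 3) (k / 3) (k / 3 + 2)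

theorem balancedCount_three_mul (m : ℕ) : balancedCount (3 * m) = meetCount m m m := by
  simp [balancedCount]

theorem balancedCount_three_mul_add_four (m : ℕ) :
    balancedCount (3 * m + 4) = meetCount m (m + 2) (m + 2) := by
  have h1 : (3 * m + 4) % 3 = 1 := by omega
  have h2 : (3 * m + 4) / 3 = m + 1 := by omega
  simp [balancedCount, h1, h2]

theorem balancedCount_three_mul_add_two (m : ℕ) :
    balancedCount (3 * m + 2) = meetCount m m (m + 2) := by
  have h1 : (3 * m + 2) % 3 = 2 := by omega
  have h2 : (3 * m + 2) / 3 = m := by omega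
  simp [balancedCount, h1, h2]

theorem balancedCount_one : balancedCount 1 = 0 := by
  simp [balancedCount, meetCount, walkSum, walkCount]

theorem balancedCount_zero : balancedCount 0 = 1 := by
  simp [balancedCount, meetCount, walkSum, walkCount]

theorem balancedCount_two : balancedCount 2 = 2 := by
  norm_num [balancedCount, meetCount, walkSum, walkCount]

theorem balancedCount_nonneg (k : ℕ) : 0 ≤ balancedCount k := by
  unfold balancedCount
  split_ifs <;> exact meetCount_nonneg _ _ _

theorem three_mul_cases (k : ℕ) :
    k = 1 ∨ ∃ m, k = 3 * m ∨ k = 3 * m + 4 ∨ k = 3 * m + 2 := by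
  rcases (by omega : k % 3 = 0 ∨ k % 3 = 1 ∨ k % 3 = 2) with h | h | h
  · exact .inr ⟨k / 3, by omega⟩
  · by_cases k = 1
    · exact .inl ‹_›
    · exact .inr ⟨k / 3 - 1, by omega⟩
  · exact .inr ⟨k / 3, by omega⟩

theorem two_mul_balancedCount_le (k : ℕ) : 2 * balancedCount k ≤ balancedCount (k + 2) := by
  rcases three_mul_cases k with rfl | ⟨m, rfl | rfl | rfl⟩
  · rw [balancedCount_one, mul_zero]
    exact balancedCount_nonneg _
  · rw [balancedCount_three_mul, balancedCount_three_mul_add_two, ← meetCount_swap m (m + 2) m,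
      ← meetCount_comm (m + 2)]
    exact two_mul_meetCount_le _ _ _
  · rw [balancedCount_three_mul_add_four, show 3 * m + 4 + 2 = 3 * (m + 2) by ring,
      balancedCount_three_mul]
    exact two_mul_meetCount_le _ _ _
  · rw [balancedCount_three_mul_add_two, show 3 * m + 2 + 2 = 3 * m + 4 by ring,
      balancedCount_three_mul_add_four, meetCount_comm m (m + 2)]
    exact two_mul_meetCount_le _ _ _

theorem balancedCount_succ_le {k : ℕ} (hk : 2 ≤ k) :
    balancedCount (k + 1) ≤ 2 * balancedCount k := by
  rcases three_mul_cases k with rfl | ⟨m, rfl | rfl | rfl⟩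
  · omega
  · obtain ⟨n, rfl⟩ : ∃ n, m = n + 1 := ⟨m - 1, by omega⟩
    rw [show 3 * (n + 1) + 1 = 3 * n + 4 by ring, balancedCount_three_mul_add_four,
      balancedCount_three_mul, meetCount_comm, meetCount_swap]
    exact meetCount_add_one_le _ _ _
  · rw [show 3 * m + 4 + 1 = 3 * (m + 1) + 2 by ring, balancedCount_three_mul_add_four,
      balancedCount_three_mul_add_two, meetCount_swap]
    exact meetCount_add_one_le m (m + 2) (m + 1)
  · rw [show 3 * m + 2 + 1 = 3 * (m + 1) by ring, balancedCount_three_mul_add_two,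
      balancedCount_three_mul]
    exact meetCount_add_one_le m m (m + 1)

theorem balancedCount_le_succ {k : ℕ} (hk : k ≠ 0) :
    balancedCount k ≤ balancedCount (k + 1) := by
  have h1 := two_mul_balancedCount_le k
  have h2 := balancedCount_succ_le (k := k + 1) (by omega)
  linarith

theorem balancedCount_add_le {n : ℕ} (hn : n ≠ 1) (j : ℕ) :
    balancedCount (n + j) ≤ 2 ^ j * balancedCount n := by
  induction j with
  | zero => simp
  | succ j ih =>
    by_cases hj : 2 ≤ n + j
    · calc balancedCount (n + j + 1) ≤ 2 * balancedCount (n + j) := balancedCount_succ_le hj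
        _ ≤ 2 * (2 ^ j * balancedCount n) := by gcongr
        _ = 2 ^ (j + 1) * balancedCount n := by ring
    · -- the exceptional value `balancedCount 1 = 0` lies on the way from `0` to `2`
      obtain rfl : n = 0 := by omega
      obtain rfl | rfl : j = 0 ∨ j = 1 := by omega
      · norm_num [balancedCount_zero, balancedCount_one]
      · norm_num [balancedCount_zero, balancedCount_two]

/-- The inductive step for `balancedCount_le_meetCount`. Balancing two lengths that differ by at
least `4` lowers the sum of the squares of the lengths. -/
theorem balancedCount_le_meetCount_of_sorted (N : ℕ)
    (ih : ∀ x y z : ℕ, x ^ 2 + y ^ 2 + z ^ 2 < N → x % 2 = y % 2 → y % 2 = z % 2 →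
      balancedCount (x + y + z) ≤ meetCount x y z)
    {x y z : ℕ} (hN : x ^ 2 + y ^ 2 + z ^ 2 = N) (h1 : x ≤ y) (h2 : y ≤ z)
    (hxy : x % 2 = y % 2) (hyz : y % 2 = z % 2) :
    balancedCount (x + y + z) ≤ meetCount x y z := by
  rcases lt_or_ge z (x + 4) with h | h
  · obtain rfl | rfl : z = x ∨ z = x + 2 := by omega
    · obtain rfl : y = z := by omega
      rw [show y + y + y = 3 * y by ring, balancedCount_three_mul]
    · obtain rfl | rfl : y = x ∨ y = x + 2 := by omega
      · rw [show y + y + (y + 2) = 3 * y + 2 by ring, balancedCount_three_mul_add_two]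
      · rw [show x + (x + 2) + (x + 2) = 3 * x + 4 by ring, balancedCount_three_mul_add_four]
  · obtain ⟨u, rfl⟩ : ∃ u, z = u + 2 := ⟨z - 2, by omega⟩
    have := ih (x + 2) y u (by nlinarith) (by omega) (by omega)
    rw [show x + y + (u + 2) = x + 2 + y + u by ring]
    refine this.trans ?_
    rw [meetCount_swap, meetCount_swap x]
    exact meetCount_balance_le (by omega) y

theorem balancedCount_le_meetCount {x y z : ℕ} (hxy : x % 2 = y % 2) (hyz : y % 2 = z % 2) :
    balancedCount (x + y + z) ≤ meetCount x y z := by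
  induction hN : x ^ 2 + y ^ 2 + z ^ 2 using Nat.strong_induction_on generalizing x y z with
  | _ N ih =>
  have key := @balancedCount_le_meetCount_of_sorted N
    (fun x y z h h1 h2 => ih _ h h1 h2 rfl)
  rcases le_total x y with h1 | h1 <;> rcases le_total y z with h2 | h2 <;>
    rcases le_total x z with h3 | h3
  · exact key hN h1 h2 hxy hyz
  · exact key hN h1 h2 hxy hyz
  · rw [add_right_comm, meetCount_swap]
    exact key (by rw [← hN]; ring) h3 h2 (by omega) (by omega)
  · rw [show x + y + z = z + x + y by ring, meetCount_swap, meetCount_comm]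
    exact key (by rw [← hN]; ring) h3 h1 (by omega) (by omega)
  · rw [add_comm x, meetCount_comm]
    exact key (by rw [← hN]; ring) h1 h3 (by omega) (by omega)
  · rw [show x + y + z = y + z + x by ring, meetCount_comm, meetCount_swap]
    exact key (by rw [← hN]; ring) h2 h3 (by omega) (by omega)
  all_goals
    rw [show x + y + z = z + y + x by ring, meetCount_comm, meetCount_swap, meetCount_comm]
    exact key (by rw [← hN]; ring) h2 h1 (by omega) (by omega)

/-- The lower bound for the number of splitters, with the lengths `a`, `c` already adjusted to the
parity of `b` and `d` points outside both sets. -/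
theorem balancedCount_le_two_pow_mul_meetCount {a b c d : ℕ} :
    balancedCount (a + b + c + d) ≤
      2 ^ d * meetCount (a + (a + b) % 2) b (c + (c + b) % 2) := by
  have h := balancedCount_le_meetCount (x := a + (a + b) % 2) (y := b) (z := c + (c + b) % 2)
    (by omega) (by omega)
  set n := a + (a + b) % 2 + b + (c + (c + b) % 2) with hn
  have hn1 : n ≠ 1 := by omega
  refine le_trans ?_ (mul_le_mul_of_nonneg_left h (by positivity))
  have hle : n ≤ a + b + c + 2 := by omega
  rcases le_or_gt n (a + b + c + d) with hd | hd
  · obtain ⟨j, hj⟩ := Nat.exists_eq_add_of_le hd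
    rw [hj]
    refine (balancedCount_add_le hn1 j).trans
      (mul_le_mul_of_nonneg_right ?_ (balancedCount_nonneg n))
    exact pow_le_pow_right₀ one_le_two (by omega)
  · -- the parity adjustments exceed the number of outer points
    have h2 : balancedCount (a + b + c + d) ≤ balancedCount n := by
      obtain hj | hj : n = a + b + c + d + 1 ∨ n = a + b + c + d + 2 := by omega
      · rw [hj]
        exact balancedCount_le_succ (by omega)
      · rw [hj]
        linarith [two_mul_balancedCount_le (a + b + c + d),
          balancedCount_nonneg (a + b + c + d)]
    refine h2.trans (le_mul_of_one_le_left (balancedCount_nonneg n) ?_)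
    exact one_le_pow₀ one_le_two

/-! ### Counting splitters by walks -/

theorem splits_iff {k : ℕ} (A B : Finset (Fin k)) :
    Splits A B ↔ |(2 * (A ∩ B).card - B.card : ℤ)| ≤ 1 := by
  rw [Splits, abs_le]
  grind

theorem sum_powerset_union {α : Type*} [DecidableEq α] {X R : Finset α} (h : Disjoint X R)
    (f : Finset α → ℝ) :
    ∑ A ∈ (X ∪ R).powerset, f A = ∑ T ∈ X.powerset, ∑ U ∈ R.powerset, f (T ∪ U) := by
  induction X using Finset.induction_on generalizing f with
  | empty => simp
  | insert a X ha ih =>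
    rw [Finset.disjoint_insert_left] at h
    rw [Finset.insert_union, Finset.sum_powerset_insert (by simp [ha, h.1]),
      Finset.sum_powerset_insert ha, ih h.2, ih h.2]
    simp only [Finset.insert_union]

/-- A set `A ⊆ X` read as a choice of signs, `+1` on `A` and `-1` off `A`. -/
theorem sum_powerset_eq_walkSum {α : Type*} [DecidableEq α] (X : Finset α) (f : ℤ → ℝ) :
    ∑ A ∈ X.powerset, f (2 * A.card - X.card) = walkSum X.card f := by
  induction X using Finset.induction_on generalizing f with
  | empty => simp [walkSum]
  | insert a X ha ih =>
    rw [Finset.sum_powerset_insert ha, Finset.card_insert_of_notMem ha, walkSum, walkSum_add,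
      ← ih, ← ih]
    congr 1
    · refine Finset.sum_congr rfl fun A _ => congrArg f ?_
      push_cast; ring
    · refine Finset.sum_congr rfl fun A hA => congrArg f ?_
      rw [Finset.card_insert_of_notMem fun h => ha (Finset.mem_powerset.1 hA h)]
      push_cast; ring

/-- A walk of `n` steps ends within distance `1` of `-v`: by symmetry it ends at `v`, or it can be
extended by one step to a walk that ends at `v`. -/
theorem walkSum_abs_add_le_one (n : ℕ) (v : ℤ) :
    walkSum n (fun w => if |w + v| ≤ 1 then 1 else 0) = walkCount n v + walkCount (n + 1) v := by
  have : (fun w : ℤ => if |w + v| ≤ 1 then (1 : ℝ) else 0) = fun w =>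
      (if w = -v then 1 else 0) +
        ((if w = -(v - 1) then 1 else 0) + (if w = -(v + 1) then 1 else 0)) := by
    ext w
    have : |w + v| ≤ 1 ↔ w = -v ∨ w = -(v - 1) ∨ w = -(v + 1) := by
      rw [abs_le]; omega
    grind
  rw [this, walkSum_add, walkSum_add, walkSum_single, walkSum_single, walkSum_single,
    walkCount_neg, walkCount_neg, walkCount_neg, walkCount_succ]

/-- At the points of parity `b`, one of the two counts vanishes. -/
theorem walkCount_add_walkCount_succ (a b : ℕ) {v : ℤ} (h : Even (v + b)) :
    walkCount a v + walkCount (a + 1) v = walkCount (a + (a + b) % 2) v := by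
  rcases Nat.mod_two_eq_zero_or_one (a + b) with h0 | h0
  · rw [h0, walkCount_eq_zero_of_odd (n := a + 1) (by grind), add_zero, add_zero]
  · rw [h0, walkCount_eq_zero_of_odd (n := a) (by grind), zero_add]

/-- The number of splitters is a number of triples of walks with a common end point: a splitter
restricts to sign choices on the three parts of `B₁ ∪ B₂`, and an arbitrary set outside. -/
theorem numSplitters_eq {k a b c d : ℕ} {B₁ B₂ : Finset (Fin k)}
    (h : HasArrangement B₁ B₂ a b c d) :
    (numSplitters B₁ B₂ : ℝ) =
      2 ^ d * meetCount (a + (a + b) % 2) b (c + (c + b) % 2) := by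
  classical
  obtain ⟨ha, hb, hc, hd⟩ := h
  set X := B₁ \ B₂ with hX
  set Y := B₁ ∩ B₂ with hY
  set Z := B₂ \ B₁ with hZ
  set W := B₁ᶜ ∩ B₂ᶜ with hW
  have hB₁ : B₁ = X ∪ Y := by ext i; simp [hX, hY]; tauto
  have hB₂ : B₂ = Y ∪ Z := by ext i; simp [hZ, hY]; tauto
  have hXY : Disjoint X Y := by rw [Finset.disjoint_left]; grind
  have hYZ : Disjoint Y Z := by rw [Finset.disjoint_left]; grind
  have hYZX : Disjoint Y (X ∪ Z) := by rw [Finset.disjoint_left]; grind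
  have hXZ : Disjoint X Z := by rw [Finset.disjoint_left]; grind
  have hWd : Disjoint W (Y ∪ (X ∪ Z)) := by
    rw [Finset.disjoint_left]; grind [Finset.mem_compl]
  have huniv : (Finset.univ : Finset (Fin k)) = W ∪ (Y ∪ (X ∪ Z)) := by
    ext i
    simp only [hX, hY, hZ, hW, Finset.mem_univ, Finset.mem_union, Finset.mem_inter,
      Finset.mem_compl, Finset.mem_sdiff, true_iff]
    tauto
  have hc₁ : B₁.card = a + b := by rw [hB₁, Finset.card_union_of_disjoint hXY, ha, hb]
  have hc₂ : B₂.card = b + c := by rw [hB₂, Finset.card_union_of_disjoint hYZ, hb, hc]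
  have hsum : (numSplitters B₁ B₂ : ℝ) = ∑ V ∈ W.powerset, ∑ S ∈ Y.powerset,
      (∑ T ∈ X.powerset, if |(2 * T.card - X.card : ℤ) + (2 * S.card - Y.card)| ≤ 1
        then (1 : ℝ) else 0) *
      ∑ U ∈ Z.powerset, if |(2 * U.card - Z.card : ℤ) + (2 * S.card - Y.card)| ≤ 1
        then (1 : ℝ) else 0 := by
    rw [numSplitters, Finset.card_filter, Nat.cast_sum, ← Finset.powerset_univ, huniv,
      sum_powerset_union hWd]
    refine Finset.sum_congr rfl fun V hV => ?_
    rw [sum_powerset_union hYZX]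
    refine Finset.sum_congr rfl fun S hS => ?_
    rw [sum_powerset_union hXZ, Finset.sum_mul_sum]
    refine Finset.sum_congr rfl fun T hT => Finset.sum_congr rfl fun U hU => ?_
    rw [Finset.mem_powerset] at hV hS hT hU
    have hV' {i} (h : i ∈ V) : i ∉ B₁ ∧ i ∉ B₂ := by simpa [hW] using hV h
    have hS' {i} (h : i ∈ S) : i ∈ B₁ ∧ i ∈ B₂ := by simpa [hY] using hS h
    have hT' {i} (h : i ∈ T) : i ∈ B₁ ∧ i ∉ B₂ := by simpa [hX] using hT h
    have hU' {i} (h : i ∈ U) : i ∈ B₂ ∧ i ∉ B₁ := by simpa [hZ] using hU h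
    have e₁ : (V ∪ (S ∪ (T ∪ U))) ∩ B₁ = T ∪ S := by
      ext i
      have := @hV' i; have := @hS' i; have := @hT' i; have := @hU' i
      simp only [Finset.mem_inter, Finset.mem_union]
      tauto
    have e₂ : (V ∪ (S ∪ (T ∪ U))) ∩ B₂ = U ∪ S := by
      ext i
      have := @hV' i; have := @hS' i; have := @hT' i; have := @hU' i
      simp only [Finset.mem_inter, Finset.mem_union]
      tauto
    have c₁ : (T ∪ S).card = T.card + S.card :=
      Finset.card_union_of_disjoint (hXY.mono hT hS)
    have c₂ : (U ∪ S).card = U.card + S.card :=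
      Finset.card_union_of_disjoint (hYZ.symm.mono hU hS)
    rw [splits_iff, splits_iff, e₁, e₂, c₁, c₂, hc₁, hc₂, ha, hb, hc, ite_zero_mul_ite_zero,
      mul_one, Nat.cast_ite, Nat.cast_one, Nat.cast_zero]
    congr 1
    push_cast
    ring_nf
  have hX' (v : ℤ) := sum_powerset_eq_walkSum X fun w => if |w + v| ≤ 1 then (1 : ℝ) else 0
  have hZ' (v : ℤ) := sum_powerset_eq_walkSum Z fun w => if |w + v| ≤ 1 then (1 : ℝ) else 0
  simp only [hX', hZ', walkSum_abs_add_le_one] at hsum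
  rw [hsum, sum_powerset_eq_walkSum Y fun v => (walkCount X.card v + walkCount (X.card + 1) v) *
    (walkCount Z.card v + walkCount (Z.card + 1) v), Finset.sum_const, Finset.card_powerset,
    nsmul_eq_mul, ha, hb, hc, hd, Nat.cast_pow, Nat.cast_ofNat, meetCount_swap, meetCount]
  congr 1
  refine walkSum_congr fun s _ hs => ?_
  rw [walkCount_add_walkCount_succ a b hs, walkCount_add_walkCount_succ c b hs]

theorem HasArrangement.sum_eq {k a b c d : ℕ} {B₁ B₂ : Finset (Fin k)}
    (h : HasArrangement B₁ B₂ a b c d) : a + b + c + d = k := by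
  obtain ⟨ha, hb, hc, hd⟩ := h
  have h1 := Finset.card_sdiff_add_card_inter B₁ B₂
  have h2 := Finset.card_union_add_card_inter B₁ B₂
  have h3 := Finset.card_sdiff_add_card_inter B₂ B₁
  have h4 := Finset.card_add_card_compl (B₁ ∪ B₂)
  rw [Finset.inter_comm] at h3
  rw [Finset.compl_union, Fintype.card_fin] at h4
  omega

theorem exists_hasArrangement {k a b c d : ℕ} (h : a + b + c + d = k) :
    ∃ B₁ B₂ : Finset (Fin k), HasArrangement B₁ B₂ a b c d := by
  obtain ⟨X, -, hX⟩ := Finset.exists_subset_card_eq (s := (Finset.univ : Finset (Fin k)))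
    (n := a) (by simp; omega)
  have hXc := Finset.card_add_card_compl X
  rw [Fintype.card_fin] at hXc
  obtain ⟨Y, hYs, hY⟩ := Finset.exists_subset_card_eq (s := Xᶜ) (n := b) (by omega)
  have hYc := Finset.card_sdiff_add_card_eq_card hYs
  obtain ⟨Z, hZs, hZ⟩ := Finset.exists_subset_card_eq (s := Xᶜ \ Y) (n := c) (by omega)
  have e₁ : (X ∪ Y) \ (Y ∪ Z) = X := by
    ext i; have := @hYs i; have := @hZs i; simp at *; tauto
  have e₂ : (X ∪ Y) ∩ (Y ∪ Z) = Y := by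
    ext i; have := @hYs i; have := @hZs i; simp at *; tauto
  have e₃ : (Y ∪ Z) \ (X ∪ Y) = Z := by
    ext i; have := @hYs i; have := @hZs i; simp at *; tauto
  have e₄ : (X ∪ Y)ᶜ ∩ (Y ∪ Z)ᶜ = (Xᶜ \ Y) \ Z := by
    ext i; simp; tauto
  have hZc := Finset.card_sdiff_add_card_eq_card hZs
  exact ⟨X ∪ Y, Y ∪ Z, by rw [e₁, hX], by rw [e₂, hY], by rw [e₃, hZ], by rw [e₄]; omega⟩

theorem balancedCount_le_numSplitters {k : ℕ} (B₁ B₂ : Finset (Fin k)) :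
    balancedCount k ≤ numSplitters B₁ B₂ := by
  have h : HasArrangement B₁ B₂ _ _ _ _ := ⟨rfl, rfl, rfl, rfl⟩
  rw [numSplitters_eq h]
  nth_rw 1 [← h.sum_eq]
  exact balancedCount_le_two_pow_mul_meetCount

theorem minimizesSplitters_of_meetCount_eq {k a b c : ℕ} (hk : a + b + c = k)
    (hab : a % 2 = b % 2) (hbc : b % 2 = c % 2) (h : meetCount a b c = balancedCount k) :
    MinimizesSplitters k a b c 0 := by
  refine ⟨exists_hasArrangement hk, fun B₁ B₂ hB C₁ C₂ => ?_⟩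
  have h1 := numSplitters_eq hB
  rw [show (a + b) % 2 = 0 by omega, show (c + b) % 2 = 0 by omega, pow_zero, one_mul, add_zero,
    add_zero, h] at h1
  exact_mod_cast h1.trans_le (balancedCount_le_numSplitters C₁ C₂)

theorem minSplitters_eq {k : ℕ} (hk : k ≠ 1) : (minSplitters k : ℝ) = balancedCount k := by
  have key {a b c : ℕ} (hs : a + b + c = k) (hab : a % 2 = b % 2) (hbc : b % 2 = c % 2)
      (h : meetCount a b c = balancedCount k) : (minSplitters k : ℝ) = balancedCount k := by
    obtain ⟨⟨B₁, B₂, hB⟩, hmin⟩ := minimizesSplitters_of_meetCount_eq hs hab hbc h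
    have h1 := numSplitters_eq hB
    rw [show (a + b) % 2 = 0 by omega, show (c + b) % 2 = 0 by omega, pow_zero, one_mul, add_zero,
      add_zero, h] at h1
    rw [← h1, minSplitters]
    congr 1
    exact le_antisymm (ciInf_le (OrderBot.bddBelow _) (B₁, B₂))
      (le_ciInf fun p => hmin B₁ B₂ hB p.1 p.2)
  rcases three_mul_cases k with rfl | ⟨m, rfl | rfl | rfl⟩
  · exact absurd rfl hk
  · exact key (by ring) rfl rfl (balancedCount_three_mul m).symm
  · exact key (by ring) (by omega) rfl (balancedCount_three_mul_add_four m).symm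
  · exact key (by ring) rfl (by omega) (balancedCount_three_mul_add_two m).symm

open Filter Topology

/-! ### The sum of the cubes of the binomial coefficients -/

theorem walkCount_center_succ (r : ℕ) :
    (r + 1) * walkCount (2 * (r + 1)) 0 = 2 * (2 * r + 1) * walkCount (2 * r) 0 := by
  have h1 := walkCount_ratio (2 * r) 1
  have h2 := walkCount_neg (2 * r) 2
  have h3 : walkCount (2 * (r + 1)) 0 =
      walkCount (2 * r) (-2) + 2 * walkCount (2 * r) 0 + walkCount (2 * r) 2 := by
    rw [show 2 * (r + 1) = 2 * r + 1 + 1 by ring, walkCount_succ, walkCount_succ, walkCount_succ]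
    norm_num
    ring
  norm_num at h1
  rw [h3, h2]
  linear_combination h1

theorem walkCount_center_pos (r : ℕ) : 0 < walkCount (2 * r) 0 := by
  induction r with
  | zero => simp [walkCount]
  | succ r ih =>
    have h := walkCount_center_succ r
    have : 0 < 2 * (2 * r + 1) * walkCount (2 * r) 0 := by positivity
    rw [← h] at this
    exact pos_of_mul_pos_right this (by positivity)

/-- The central binomial coefficients in terms of the Wallis product. -/
theorem walkCount_center_sq_mul_wallis (r : ℕ) :
    walkCount (2 * r) 0 ^ 2 * ((2 * r + 1) * Real.Wallis.W r) = (4 ^ r) ^ 2 := by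
  induction r with
  | zero => simp [walkCount, Real.Wallis.W]
  | succ r ih =>
    have h : walkCount (2 * (r + 1)) 0 = 2 * (2 * r + 1) * walkCount (2 * r) 0 / (r + 1) := by
      rw [← walkCount_center_succ]; field_simp
    rw [h, Real.Wallis.W_succ, pow_succ (4 : ℝ), mul_pow, ← ih]
    push_cast
    field_simp
    ring

theorem tendsto_sqrt_mul_walkCount_center :
    Tendsto (fun r : ℕ => √r * (walkCount (2 * r) 0 / 4 ^ r)) atTop (𝓝 (1 / √Real.pi)) := by
  have h0 : Tendsto (fun r : ℕ => (r / (2 * r + 1) : ℝ)) atTop (𝓝 (1 / 2)) := by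
    have h : Tendsto (fun r : ℕ => (1 / (2 * r + 1) : ℝ)) atTop (𝓝 0) :=
      (tendsto_const_nhds.div_atTop (tendsto_atTop_add_const_right _ _
        (tendsto_natCast_atTop_atTop.const_mul_atTop two_pos)))
    have := (h.const_sub 1).const_mul (1 / 2)
    norm_num at this
    refine this.congr fun r => ?_
    field_simp
    ring
  have h1 := (h0.div Real.Wallis.tendsto_W_nhds_pi_div_two (by positivity)).sqrt
  rw [show (1 / 2 / (Real.pi / 2) : ℝ) = 1 / Real.pi by field_simp, Real.sqrt_div zero_le_one,
    Real.sqrt_one] at h1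
  refine h1.congr fun r => ?_
  have hW := Real.Wallis.W_pos r
  have hc := walkCount_center_pos r
  have h := walkCount_center_sq_mul_wallis r
  rw [← Real.sqrt_sq (by positivity : 0 ≤ walkCount (2 * r) 0 / 4 ^ r),
    ← Real.sqrt_mul (by positivity)]
  congr 1
  simp only [Pi.div_apply]
  rw [div_pow, ← h]
  field_simp

theorem walkCount_even_ratio (r t : ℕ) :
    (r + t + 1) * walkCount (2 * r) (2 * (t + 1 : ℕ)) = (r - t) * walkCount (2 * r) (2 * t) := by
  have h := walkCount_ratio (2 * r) (2 * t + 1)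
  push_cast at *
  rw [show (2 * t + 1 + 1 : ℤ) = 2 * (t + 1) by ring, add_sub_cancel_right] at h
  linear_combination h / 2

/-- The binomial coefficients of the row `2 * r`, normalized at the centre. -/
noncomputable def normCount (r : ℕ) (s : ℤ) : ℝ := walkCount (2 * r) s / walkCount (2 * r) 0

theorem normCount_nonneg (r : ℕ) (s : ℤ) : 0 ≤ normCount r s :=
  div_nonneg (walkCount_nonneg _ _) (walkCount_nonneg _ _)

theorem normCount_zero (r : ℕ) : normCount r 0 = 1 := div_self (walkCount_center_pos r).ne'

theorem normCount_neg (r : ℕ) (s : ℤ) : normCount r (-s) = normCount r s := by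
  rw [normCount, walkCount_neg, normCount]

theorem normCount_eq_zero_of_odd (r : ℕ) {s : ℤ} (h : Odd s) : normCount r s = 0 := by
  rw [normCount, walkCount_eq_zero_of_odd (by push_cast; grind), zero_div]

theorem normCount_succ (r t : ℕ) :
    normCount r (2 * (t + 1 : ℕ)) = (r - t) / (r + t + 1) * normCount r (2 * t) := by
  have h := walkCount_even_ratio r t
  rw [normCount, normCount, div_mul_div_comm, mul_comm (r + t + 1 : ℝ), ← div_div,
    div_right_comm, ← h]
  field_simp

theorem normCount_eq_zero_of_lt {r t : ℕ} (h : r < t) : normCount r (2 * t) = 0 := by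
  rw [normCount, walkCount_eq_zero_of_lt_abs, zero_div]
  rw [abs_of_nonneg (by positivity)]
  push_cast; omega

/-- With `v = (2 * t + 1) / (2 * r + 1)` the ratio of consecutive values is `(1 - v) / (1 + v)`,
and `3 * artanh v ≤ artanh (3 * v)`. The choice `r = 3 * q + 1` makes `2 * r + 1` exactly three
times `2 * q + 1`. -/
theorem normCount_le_normCount_pow_three (q t : ℕ) :
    normCount q (2 * t) ≤ normCount (3 * q + 1) (2 * t) ^ 3 := by
  induction t with
  | zero => simp [normCount_zero]
  | succ t ih =>
    rcases lt_or_ge q (t + 1) with h | h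
    · rw [normCount_eq_zero_of_lt h]
      exact pow_nonneg (normCount_nonneg _ _) 3
    · have hqt : (t : ℝ) + 1 ≤ q := by exact_mod_cast h
      have ht : (0 : ℝ) ≤ t := t.cast_nonneg
      rw [normCount_succ, normCount_succ, mul_pow]
      refine mul_le_mul ?_ ih (normCount_nonneg _ _) ?_
      · rw [div_pow, div_le_div_iff₀ (by positivity) (by positivity)]
        push_cast
        have : 0 ≤ (2 * t + 1 : ℝ) ^ 3 * (2 * q + 1) := by positivity
        linear_combination this
      · exact pow_nonneg (div_nonneg (by push_cast; linarith) (by positivity)) 3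

theorem one_sub_div_one_add_le_exp {v : ℝ} (h0 : 0 ≤ v) (h1 : v < 1) :
    (1 - v) / (1 + v) ≤ Real.exp (-2 * v) := by
  have h := (Real.hasSum_log_sub_log_of_abs_lt_one (by rwa [abs_of_nonneg h0]))
  have := le_hasSum h 0 fun k _ => by positivity
  norm_num at this
  rw [← Real.log_le_iff_le_exp (div_pos (by linarith) (by linarith)),
    Real.log_div (by linarith) (by linarith)]
  linarith

theorem normCount_le_exp (r t : ℕ) :
    normCount r (2 * t) ≤ Real.exp (-(t ^ 2 / (r + 1 / 2))) := by
  induction t with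
  | zero => simp [normCount_zero]
  | succ t ih =>
    rcases lt_or_ge r (t + 1) with h | h
    · rw [normCount_eq_zero_of_lt h]
      positivity
    · have hrt : (t : ℝ) + 1 ≤ r := by exact_mod_cast h
      have ht : (0 : ℝ) ≤ t := t.cast_nonneg
      have h1 := one_sub_div_one_add_le_exp (v := (t + 1 / 2) / (r + 1 / 2)) (by positivity)
        ((div_lt_one (by positivity)).2 (by linarith))
      have e1 : (1 - (t + 1 / 2) / (r + 1 / 2)) / (1 + (t + 1 / 2) / (r + 1 / 2) : ℝ) =
          (r - t) / (r + t + 1) := by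
        field_simp
        ring
      rw [e1] at h1
      rw [normCount_succ]
      refine (mul_le_mul h1 ih (normCount_nonneg _ _) (Real.exp_nonneg _)).trans_eq ?_
      rw [← Real.exp_add]
      congr 1
      push_cast
      field_simp
      ring

/-- The sum over the row `2 * r` of the `p`-th powers of the normalized binomial coefficients. It is
written as a sum over the right half `0, 2, …, 2 * r` of the row, which by symmetry is doubled, with
the value `1` at the centre counted once. -/
noncomputable def normSum (p r : ℕ) : ℝ :=
  2 * ∑ t ∈ Finset.range (r + 1), normCount r (2 * t) ^ p - 1

theorem sum_Icc_normCount_pow {p : ℕ} (hp : p ≠ 0) (r : ℕ) :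
    ∑ s ∈ Finset.Icc (-(2 * r : ℕ) : ℤ) (2 * r : ℕ), normCount r s ^ p = normSum p r := by
  have hodd : ∀ n : ℕ, ∑ s ∈ Finset.range (2 * n + 1), normCount r s ^ p =
      ∑ t ∈ Finset.range (n + 1), normCount r (2 * t) ^ p := by
    intro n
    induction n with
    | zero => simp
    | succ n ih =>
      rw [Finset.sum_range_succ _ (n + 1), ← ih, mul_add, mul_one,
        show 2 * n + 2 + 1 = 2 * n + 1 + 1 + 1 by ring, Finset.sum_range_succ,
        Finset.sum_range_succ, normCount_eq_zero_of_odd r (s := (2 * n + 1 : ℕ))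
        (by push_cast; simp), zero_pow hp, add_zero]
      norm_num
      ring_nf
  rw [Finset.sum_Icc_of_even_eq_range (fun s => by rw [normCount_neg]), hodd, normCount_zero,
    normSum, one_pow, two_nsmul, two_mul]

theorem four_pow_eq (q : ℕ) : (4 : ℝ) ^ q = walkCount (2 * q) 0 * normSum 1 q := by
  have h := walkSum_eq_sum (le_refl (2 * q)) fun _ => 1
  rw [walkSum_one, pow_mul] at h
  rw [← sum_Icc_normCount_pow one_ne_zero, Finset.mul_sum]
  norm_num at *
  rw [h]
  refine Finset.sum_congr rfl fun s _ => ?_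
  rw [normCount, mul_div_cancel₀ _ (walkCount_center_pos q).ne']

theorem meetCount_eq_mul_normSum (r : ℕ) :
    meetCount (2 * r) (2 * r) (2 * r) = walkCount (2 * r) 0 ^ 3 * normSum 3 r := by
  rw [meetCount_eq_sum le_rfl, ← sum_Icc_normCount_pow three_ne_zero, Finset.mul_sum]
  refine Finset.sum_congr rfl fun s _ => ?_
  rw [← mul_pow, normCount, mul_div_cancel₀ _ (walkCount_center_pos r).ne']
  ring

theorem normSum_one_le (q : ℕ) : normSum 1 q ≤ normSum 3 (3 * q + 1) := by
  have h1 : ∑ t ∈ Finset.range (q + 1), normCount q (2 * t) ^ 1 ≤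
      ∑ t ∈ Finset.range (q + 1), normCount (3 * q + 1) (2 * t) ^ 3 :=
    Finset.sum_le_sum fun t _ => by
      rw [pow_one]; exact normCount_le_normCount_pow_three q t
  have h2 : ∑ t ∈ Finset.range (q + 1), normCount (3 * q + 1) (2 * t) ^ 3 ≤
      ∑ t ∈ Finset.range (3 * q + 1 + 1), normCount (3 * q + 1) (2 * t) ^ 3 :=
    Finset.sum_le_sum_of_subset_of_nonneg (Finset.range_subset_range.2 (by omega))
      fun t _ _ => pow_nonneg (normCount_nonneg _ _) 3
  unfold normSum
  linarith

theorem sum_exp_neg_mul_sq_le {a : ℝ} (ha : 0 < a) (n : ℕ) :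
    ∑ t ∈ Finset.range n, Real.exp (-a * ((t + 1 : ℕ) : ℝ) ^ 2) ≤ √(Real.pi / a) / 2 := by
  have hanti : AntitoneOn (fun x : ℝ => Real.exp (-a * x ^ 2)) (Set.Icc 0 (0 + n)) := by
    intro x hx y _ hxy
    have := pow_le_pow_left₀ hx.1 hxy 2
    exact Real.exp_le_exp.2 (by nlinarith)
  have h := hanti.sum_le_integral
  simp only [zero_add] at h
  refine h.trans ?_
  rw [← integral_gaussian_Ioi, intervalIntegral.integral_of_le n.cast_nonneg]
  exact MeasureTheory.setIntegral_mono_set (integrable_exp_neg_mul_sq ha).integrableOn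
    (Eventually.of_forall fun x => (Real.exp_pos _).le)
    (Eventually.of_forall fun x hx => hx.1)

theorem normSum_three_le (q : ℕ) :
    normSum 3 (3 * q + 1) ≤ 1 + √(Real.pi * (q + 1 / 2)) := by
  have h := sum_exp_neg_mul_sq_le (a := 1 / (q + 1 / 2)) (by positivity) (3 * q + 1)
  rw [div_div_eq_mul_div, div_one] at h
  have h2 : ∑ t ∈ Finset.range (3 * q + 1), normCount (3 * q + 1) (2 * (t + 1 : ℕ)) ^ 3 ≤
      ∑ t ∈ Finset.range (3 * q + 1),
        Real.exp (-(1 / (q + 1 / 2)) * ((t + 1 : ℕ) : ℝ) ^ 2) := by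
    refine Finset.sum_le_sum fun t _ => ?_
    refine (pow_le_pow_left₀ (normCount_nonneg _ _) (normCount_le_exp _ (t + 1)) 3).trans_eq ?_
    rw [← Real.exp_nat_mul]
    congr 1
    push_cast
    field_simp
    ring
  rw [normSum, Finset.sum_range_succ']
  norm_num [normCount_zero] at *
  linarith

/-! ### The asymptotic value of the minimum -/

theorem tendsto_one_div_mul_add {c : ℝ} (hc : 0 < c) (d : ℝ) :
    Tendsto (fun q : ℕ => 1 / (c * q + d)) atTop (𝓝 0) :=
  tendsto_const_nhds.div_atTop (tendsto_atTop_add_const_right _ _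
    (tendsto_natCast_atTop_atTop.const_mul_atTop hc))

theorem tendsto_normSum_three_div_sqrt :
    Tendsto (fun q : ℕ => normSum 3 (3 * q + 1) / √(3 * q + 1)) atTop
      (𝓝 (√Real.pi / √3)) := by
  have hε := tendsto_one_div_mul_add three_pos 1
  have hpi : √Real.pi ≠ 0 := by positivity
  have hlow : Tendsto (fun q : ℕ => (√q * (walkCount (2 * q) 0 / 4 ^ q))⁻¹ * √(q / (3 * q + 1)))
      atTop (𝓝 (√Real.pi / √3)) := by
    have h1 := tendsto_sqrt_mul_walkCount_center.inv₀ (by positivity)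
    have h2 : Tendsto (fun q : ℕ => (q / (3 * q + 1) : ℝ)) atTop (𝓝 (1 / 3)) := by
      have := (hε.const_sub 1).div_const 3
      rw [sub_zero] at this
      refine this.congr fun q => ?_
      field_simp
      ring
    have := h1.mul h2.sqrt
    rwa [one_div, inv_inv, Real.sqrt_div zero_le_one, Real.sqrt_one, mul_one_div] at this
  have hup : Tendsto (fun q : ℕ => √(1 / (3 * q + 1)) + √(Real.pi * ((q + 1 / 2) / (3 * q + 1))))
      atTop (𝓝 (√Real.pi / √3)) := by
    have h2 : Tendsto (fun q : ℕ => ((q + 1 / 2) / (3 * q + 1) : ℝ)) atTop (𝓝 (1 / 3)) := by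
      have := (hε.div_const 6).const_add (1 / 3)
      rw [zero_div, add_zero] at this
      refine this.congr fun q => ?_
      field_simp
      ring
    have := hε.sqrt.add (h2.const_mul Real.pi).sqrt
    rwa [Real.sqrt_zero, zero_add, mul_one_div, Real.sqrt_div Real.pi_pos.le] at this
  refine tendsto_of_tendsto_of_tendsto_of_le_of_le' hlow hup ?_ ?_
  · filter_upwards [eventually_gt_atTop 0] with q hq
    have hq' : (0 : ℝ) < q := by exact_mod_cast hq
    have hc := walkCount_center_pos q
    rw [Real.sqrt_div hq'.le, ← mul_div_assoc]
    gcongr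
    refine le_of_eq_of_le ?_ (normSum_one_le q)
    rw [four_pow_eq]
    have : normSum 1 q ≠ 0 := fun h => by
      have := four_pow_eq q
      rw [h, mul_zero] at this
      exact (pow_pos four_pos q).ne' this
    field_simp
  · refine Eventually.of_forall fun q => ?_
    rw [← mul_div_assoc, Real.sqrt_div zero_le_one, Real.sqrt_div (by positivity), ← add_div,
      Real.sqrt_one]
    gcongr
    exact normSum_three_le q

theorem tendsto_balancedCount_subseq :
    Tendsto (fun q : ℕ => (18 * q + 6 : ℝ) * (balancedCount (18 * q + 6) / 2 ^ (18 * q + 6)))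
      atTop (𝓝 (2 * √3 / Real.pi)) := by
  have hr : Tendsto (fun q : ℕ => 3 * q + 1) atTop atTop :=
    tendsto_atTop_mono (fun q => by simp only [id]; omega) tendsto_id
  have h := (((tendsto_sqrt_mul_walkCount_center.comp hr).pow 3).const_mul 6).mul
    tendsto_normSum_three_div_sqrt
  have hlim : 6 * (1 / √Real.pi) ^ 3 * (√Real.pi / √3) = 2 * √3 / Real.pi := by
    have h3 : √3 ^ 2 = (3 : ℝ) := Real.sq_sqrt (by norm_num)
    have hp : √Real.pi ^ 2 = Real.pi := Real.sq_sqrt Real.pi_pos.le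
    have : √Real.pi ≠ 0 := by positivity
    nth_rw 3 [← hp]
    field_simp
    rw [h3]
    norm_num
  rw [hlim] at h
  refine h.congr fun q => ?_
  have hs : √(3 * q + 1 : ℝ) ^ 2 = 3 * q + 1 := Real.sq_sqrt (by positivity)
  have hs0 : √(3 * q + 1 : ℝ) ≠ 0 := by positivity
  rw [show 18 * q + 6 = 3 * (2 * (3 * q + 1)) by ring, balancedCount_three_mul,
    meetCount_eq_mul_normSum, show 3 * (2 * (3 * q + 1)) = 2 * (3 * q + 1) * 3 by ring, pow_mul,
    pow_mul, show (2 : ℝ) ^ 2 = 4 by norm_num]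
  simp only [Function.comp_apply]
  push_cast
  rw [show (18 * q + 6 : ℝ) = 6 * √(3 * q + 1 : ℝ) ^ 2 by rw [hs]; ring]
  field_simp

theorem balancedCount_div_le {m n : ℕ} (hm : 2 ≤ m) (h : m ≤ n) :
    balancedCount n / 2 ^ n ≤ balancedCount m / 2 ^ m := by
  obtain ⟨j, rfl⟩ := Nat.exists_eq_add_of_le h
  rw [div_le_div_iff₀ (by positivity) (by positivity), pow_add]
  nlinarith [balancedCount_add_le (n := m) (by omega) j, pow_pos (two_pos (α := ℝ)) m]

/-- The limit along all integers follows from that along an arithmetic progression, because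
`balancedCount k / 2 ^ k` is decreasing for `k ≥ 2`. -/
theorem tendsto_balancedCount :
    Tendsto (fun k : ℕ => (k : ℝ) * (balancedCount k / 2 ^ k)) atTop
      (𝓝 (2 * √3 / Real.pi)) := by
  have hq : Tendsto (fun k : ℕ => (k - 6) / 18) atTop atTop :=
    (Nat.tendsto_div_const_atTop (by norm_num)).comp (tendsto_sub_atTop_nat 6)
  have hA := tendsto_balancedCount_subseq
  have hup : Tendsto (fun q : ℕ => (18 * q + 6 : ℝ) *
      (balancedCount (18 * q + 6) / 2 ^ (18 * q + 6)) * (1 + 18 * (1 / (18 * q + 6)))) atTop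
      (𝓝 (2 * √3 / Real.pi)) := by
    have := hA.mul (((tendsto_one_div_mul_add (c := 18) (by norm_num) 6).const_mul 18).const_add 1)
    rwa [mul_zero, add_zero, mul_one] at this
  have hlow : Tendsto (fun q : ℕ => (18 * (q + 1 : ℕ) + 6 : ℝ) *
      (balancedCount (18 * (q + 1) + 6) / 2 ^ (18 * (q + 1) + 6)) *
      (1 - 18 * (1 / (18 * (q + 1 : ℕ) + 6)))) atTop (𝓝 (2 * √3 / Real.pi)) := by
    have := hA.mul (((tendsto_one_div_mul_add (c := 18) (by norm_num) 6).const_mul 18).const_sub 1)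
    rw [mul_zero, sub_zero, mul_one] at this
    exact this.comp (tendsto_add_atTop_nat 1)
  refine tendsto_of_tendsto_of_tendsto_of_le_of_le' (hlow.comp hq) (hup.comp hq) ?_ ?_
  · filter_upwards [eventually_ge_atTop 6] with k hk
    simp only [Function.comp_apply]
    set q := (k - 6) / 18
    have h1 : k ≤ 18 * (q + 1) + 6 := by omega
    have h2 : 18 * q + 6 ≤ k := by omega
    have h2' : (18 * q + 6 : ℝ) ≤ k := by exact_mod_cast h2
    have h := balancedCount_div_le (by omega) h1
    have h0 : 0 ≤ balancedCount (18 * (q + 1) + 6) / 2 ^ (18 * (q + 1) + 6) :=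
      div_nonneg (balancedCount_nonneg _) (by positivity)
    refine le_trans (le_of_eq ?_) (mul_le_mul h2' h h0 k.cast_nonneg)
    push_cast
    field_simp
    ring
  · filter_upwards [eventually_ge_atTop 6] with k hk
    simp only [Function.comp_apply]
    set q := (k - 6) / 18
    have h1 : k ≤ 18 * q + 24 := by omega
    have h2 : 18 * q + 6 ≤ k := by omega
    have h1' : (k : ℝ) ≤ 18 * q + 24 := by exact_mod_cast h1
    have h := balancedCount_div_le (by omega) h2
    have h0 : 0 ≤ balancedCount k / 2 ^ k :=
      div_nonneg (balancedCount_nonneg _) (by positivity)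
    refine (mul_le_mul h1' h h0 (by positivity)).trans (le_of_eq ?_)
    field_simp
    ring

theorem mainTheorem2 :
    (∀ k m : ℕ, k = 3 * m → MinimizesSplitters k m m m 0) ∧
    (∀ k m : ℕ, 2 ≤ m → k + 2 = 3 * m → MinimizesSplitters k (m - 2) m m 0) ∧
    (∀ k m : ℕ, k = 3 * m + 2 → MinimizesSplitters k m m (m + 2) 0) ∧
    Asymptotics.IsEquivalent Filter.atTop
      (fun k : ℕ => (minSplitters k : ℝ))
      (fun k : ℕ => 2 * Real.sqrt 3 / Real.pi * ((2 : ℝ) ^ k / (k : ℝ))) := by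
  refine ⟨fun k m hk => ?_, fun k m hm hk => ?_, fun k m hk => ?_, ?_⟩
  · subst hk
    exact minimizesSplitters_of_meetCount_eq (by ring) rfl rfl (balancedCount_three_mul m).symm
  · obtain ⟨n, rfl⟩ := Nat.exists_eq_add_of_le' hm
    obtain rfl : k = 3 * n + 4 := by omega
    exact minimizesSplitters_of_meetCount_eq (by omega) (by omega) rfl
      (balancedCount_three_mul_add_four n).symm
  · subst hk
    exact minimizesSplitters_of_meetCount_eq (by ring) rfl (by omega)
      (balancedCount_three_mul_add_two m).symm
  · refine Asymptotics.isEquivalent_of_tendsto_one ?_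
    have hL : 2 * √3 / Real.pi ≠ 0 := by positivity
    have h := tendsto_balancedCount.div_const (2 * √3 / Real.pi)
    rw [div_self hL] at h
    refine h.congr' ?_
    filter_upwards [eventually_ge_atTop 2] with k hk
    rw [Pi.div_apply, minSplitters_eq (by omega)]
    have : (k : ℝ) ≠ 0 := by positivity
    field_simp
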